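/- Let $n\ge 1$, let $\mathfrak S_n$ be the set of permutations of $[n]=\{1,\dots,n\}$, and let $\mathfrak D_n\subseteq\mathfrak S_n$ be the set of derangements (permutations without fixed points). For $\sigma\in\mathfrak S_n$ let $\operatorname{wex}\sigma=\#\{i:\ i\le\sigma(i)\}$, $\operatorname{exc}\sigma=\#\{i:\ i<\sigma(i)\}$, $$\operatorname{cros}\sigma=\#\{(i,j)\in[n]\times[n]:\ i<j\le\sigma(i)<\sigma(j)\ \text{ or }\ i>j>\sigma(i)>\sigma(j)\},$$ $$\operatorname{nest}\sigma=\#\{(i,j)\in[n]\times[n]:\ i<j\le\sigma(j)<\sigma(i)\ \text{ or }\ i>j>\sigma(j)>\sigma(i)\}.$$ Let $(31\text{-}2)\sigma$ be the number of pairs $(i,j)$ with $2\le i<j\le n$ and $\sigma(i-1)>\sigma(j)>\sigma(i)$; let $(2\text{-}13)\sigma$ (respectively $(2\text{-}31)\sigma$) be the number of pairs $(i,j)$ with $1\le i<j\le n-1$ and $\sigma(j+1)>\sigma(i)>\sigma(j)$ (respectively $\sigma(j+1)<\sigma(i)<\sigma(j)$). Let $\mathfrak A_n$ be the set of falling alternating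 permutations $\sigma\in\mathfrak S_n$, i.e. those with $\sigma(1)>\sigma(2)<\sigma(3)>\sigma(4)<\cdots$. Then, for all elements $p,q$ of a commutative ring (in particular for indeterminates $p,q$), $$\sum_{\sigma\in\mathfrak S_n}(-1)^{\operatorname{wex}\sigma}p^{\operatorname{nest}\sigma}q^{\operatorname{cros}\sigma}=\begin{cases}0&\text{if $n$ is even},\\ (-1)^{\frac{n+1}{2}}\displaystyle\sum_{\sigma\in\mathfrak A_n}p^{(2\text{-}13)\sigma}q^{(31\text{-}2)\sigma}&\text{if $n$ is odd},\end{cases}$$ and, whenever $q$ is invertible, $$\sum_{\sigma\in\mathfrak D_n}\left(-\tfrac1q\right)^{\operatorname{exc}\sigma}p^{\operatorname{nest}\sigma}q^{\operatorname{cros}\sigma}=\begin{cases}\left(-\tfrac1q\right)^{\frac n2}\displaystyle\sum_{\sigma\in\mathfrak A_n}p^{(2\text{-}31)\sigma}q^{(31\text{-}2)\sigma}&\text{if $n$ is even},\\ 0&\text{if $n$ is odd}.\end{cases}$$ -/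

import Mathlib

namespace PermStat

/-- Number of weak excedances: indices `i` with `i ≤ σ(i)`. -/
def wex {n : ℕ} (σ : Equiv.Perm (Fin n)) : ℕ :=
  (Finset.univ.filter fun i : Fin n => i ≤ σ i).card

/-- Number of excedances: indices `i` with `i < σ(i)`. -/
def exc {n : ℕ} (σ : Equiv.Perm (Fin n)) : ℕ :=
  (Finset.univ.filter fun i : Fin n => i < σ i).card

/-- Number of crossings. -/
def cros {n : ℕ} (σ : Equiv.Perm (Fin n)) : ℕ :=
  (Finset.univ.filter fun x : Fin n × Fin n =>
    (x.1 < x.2 ∧ x.2 ≤ σ x.1 ∧ σ x.1 < σ x.2) ∨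
    (x.2 < x.1 ∧ σ x.1 < x.2 ∧ σ x.2 < σ x.1)).card

/-- Number of nestings. -/
def nest {n : ℕ} (σ : Equiv.Perm (Fin n)) : ℕ :=
  (Finset.univ.filter fun x : Fin n × Fin n =>
    (x.1 < x.2 ∧ x.2 ≤ σ x.2 ∧ σ x.2 < σ x.1) ∨
    (x.2 < x.1 ∧ σ x.2 < x.2 ∧ σ x.1 < σ x.2)).card

/-- Number of occurrences of the pattern 31-2: positions `a, b, c` with `b = a + 1`, `b < c`
and `σ(b) < σ(c) < σ(a)`. -/
def pat31_2 {n : ℕ} (σ : Equiv.Perm (Fin n)) : ℕ :=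
  (Finset.univ.filter fun x : Fin n × Fin n × Fin n =>
    x.1.val + 1 = x.2.1.val ∧ x.2.1 < x.2.2 ∧
      σ x.2.1 < σ x.2.2 ∧ σ x.2.2 < σ x.1).card

/-- Number of occurrences of the pattern 2-13: positions `a, b, c` with `a < b`, `c = b + 1`
and `σ(b) < σ(a) < σ(c)`. -/
def pat2_13 {n : ℕ} (σ : Equiv.Perm (Fin n)) : ℕ :=
  (Finset.univ.filter fun x : Fin n × Fin n × Fin n =>
    x.1 < x.2.1 ∧ x.2.1.val + 1 = x.2.2.val ∧
      σ x.2.1 < σ x.1 ∧ σ x.1 < σ x.2.2).card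

/-- Number of occurrences of the pattern 2-31: positions `a, b, c` with `a < b`, `c = b + 1`
and `σ(c) < σ(a) < σ(b)`. -/
def pat2_31 {n : ℕ} (σ : Equiv.Perm (Fin n)) : ℕ :=
  (Finset.univ.filter fun x : Fin n × Fin n × Fin n =>
    x.1 < x.2.1 ∧ x.2.1.val + 1 = x.2.2.val ∧
      σ x.2.2 < σ x.1 ∧ σ x.1 < σ x.2.1).card

/-- Falling alternating permutations, `σ(1) > σ(2) < σ(3) > ⋯`. Positions in `Fin n` start
at `0`, so the descents are exactly at the even positions. -/
def alternating (n : ℕ) : Finset (Equiv.Perm (Fin n)) :=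
  Finset.univ.filter fun σ => ∀ i j : Fin n, i.val + 1 = j.val →
    (i.val % 2 = 0 → σ j < σ i) ∧ (i.val % 2 = 1 → σ i < σ j)

end PermStat

/-!
All four sums are evaluated as weighted sums over Dyck paths.

For crossings and nestings, take a permutation apart level by level: at level `h`, remove the
position `h` if its value is smaller, and the value `h` if its position is not larger. The number of
positions (equally, of values) below the level that still wait for a partner is the height of a
Motzkin path, and the choice of a partner among `h` waiting ones has weight
`[h] = (q ^ h - p ^ h) / (q - p)`, since the rank of the partner determines the crossings and
nestings that are lost. The signs are such that the level steps cancel, and only Dyck paths remain.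

For alternating permutations, build the word by inserting a new smallest letter again and again,
marking those letters that are to stay valleys, so that nothing may be inserted next to them. The
number of gaps available to a marked letter is the height of a path, since an unmarked letter adds
one such gap and a marked letter removes one; the rank of the gap that is chosen determines the new
pattern occurrences. The path ends at height `0` exactly when the marked letters are every second
letter, that is, when the permutation is alternating.

The two kinds of paths carry different step weights, but a sum over Dyck paths depends only on the
product of the weights of an up step and the matching down step.
-/

namespace PermStat

open Finset

section DyckPaths

variable {R : Type*} [CommSemiring R]

/-- The weighted number of lattice paths with `r` steps `±1` from height `h` down to height `0`
that never become negative, where a step from `k` up to `k + 1` has weight `a k` and a step from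
`k + 1` down to `k` has weight `b k`. -/
def dyckSum (a b : ℕ → R) : ℕ → ℕ → R
  | 0, 0 => 1
  | 0, _ + 1 => 0
  | r + 1, 0 => a 0 * dyckSum a b r 1
  | r + 1, h + 1 => a (h + 1) * dyckSum a b r (h + 2) + b h * dyckSum a b r h

lemma eq_mul_dyckSum {a b : ℕ → R} {M : ℕ → ℕ → R} (x : R) (zero_zero : M 0 0 = x)
    (zero_succ : ∀ h, M 0 (h + 1) = 0) (succ_zero : ∀ r, M (r + 1) 0 = a 0 * M r 1)
    (succ_succ : ∀ r h, M (r + 1) (h + 1) = a (h + 1) * M r (h + 2) + b h * M r h) (r h : ℕ) :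
    M r h = x * dyckSum a b r h := by
  induction r generalizing h with
  | zero => cases h <;> simp [dyckSum, zero_zero, zero_succ]
  | succ r ih =>
    cases h with
    | zero => rw [succ_zero, ih, dyckSum, mul_left_comm]
    | succ h => rw [succ_succ, ih, ih, dyckSum]; ring

lemma dyckSum_of_odd (a b : ℕ → R) {r h : ℕ} (hrh : Odd (r + h)) : dyckSum a b r h = 0 := by
  induction r generalizing h with
  | zero => cases h <;> simp_all [dyckSum]
  | succ r ih =>
    have up : dyckSum a b r (h + 1) = 0 := ih (by rwa [add_left_comm, add_comm])
    cases h with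
    | zero => rw [dyckSum, up, mul_zero]
    | succ h =>
      have down : dyckSum a b r h = 0 := ih (by rw [Nat.odd_iff] at hrh ⊢; omega)
      rw [dyckSum, up, down, mul_zero, mul_zero, add_zero]

/-- Matching each down step with the up step it undoes, only the products `a k * b k` matter. -/
lemma dyckSum_one_mul (u : R) (a b : ℕ → R) {r h s : ℕ} (hs : r + h = 2 * s) :
    dyckSum 1 (fun k => u * (a k * b k)) r h = u ^ s * (∏ k ∈ range h, a k) * dyckSum a b r h := by
  induction r generalizing h s with
  | zero =>
    cases h with
    | zero => simp [dyckSum, show s = 0 by omega]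
    | succ h => simp [dyckSum]
  | succ r ih =>
    cases h with
    | zero => simp [dyckSum, ih (h := 1) (s := s) (by omega), mul_assoc]
    | succ h =>
      obtain ⟨s, rfl⟩ : ∃ s', s = s' + 1 := ⟨s - 1, by omega⟩
      rw [dyckSum, dyckSum, ih (s := s + 1) (by omega), ih (s := s) (by omega),
        prod_range_succ _ (h + 1), prod_range_succ, Pi.one_apply]
      ring

lemma dyckSum_one_mul_zero (u : R) (a b : ℕ → R) (n : ℕ) :
    dyckSum 1 (fun k => u * (a k * b k)) n 0 =
      if Even n then u ^ (n / 2) * dyckSum a b n 0 else 0 := by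
  split_ifs with hn
  · rw [dyckSum_one_mul u a b (s := n / 2) (by have := Nat.even_iff.mp hn; omega)]
    simp
  · exact dyckSum_of_odd _ _ (by simpa using hn)

/-- The `(p, q)`-analogue `(q ^ h - p ^ h) / (q - p)` of the natural number `h`. -/
def pqNumber (p q : R) (h : ℕ) : R := ∑ k ∈ range h, p ^ k * q ^ (h - 1 - k)

@[simp] lemma pqNumber_zero (p q : R) : pqNumber p q 0 = 0 := by simp [pqNumber]

@[simp] lemma pqNumber_one (p q : R) : pqNumber p q 1 = 1 := by simp [pqNumber]

lemma pqNumber_succ (p q : R) (h : ℕ) : pqNumber p q (h + 1) = q * pqNumber p q h + p ^ h := by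
  rw [pqNumber, pqNumber, sum_range_succ, mul_sum]
  congr 1
  · refine sum_congr rfl fun k hk => ?_
    rw [mem_range] at hk
    rw [show h + 1 - 1 - k = h - 1 - k + 1 by omega, pow_succ]
    ring
  · simp

lemma sum_Iio_eq_pqNumber (p q : R) {N : ℕ} (h : Fin N) :
    ∑ v ∈ Iio h, p ^ v.val * q ^ (h.val - 1 - v.val) = pqNumber p q h := by
  rw [pqNumber, ← Nat.Iio_eq_range, ← Fin.map_valEmbedding_Iio, sum_map]
  rfl

lemma sum_Iic_eq_pqNumber (p q : R) {N : ℕ} (h : Fin N) :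
    ∑ v ∈ Iic h, p ^ v.val * q ^ (h.val - v.val) = pqNumber p q (h + 1) := by
  rw [pqNumber, Nat.range_succ_eq_Iic, ← Fin.map_valEmbedding_Iic, sum_map]
  rfl

lemma sum_rank_eq_pqNumber {α : Type*} [LinearOrder α] (p q : R) (s : Finset α) :
    ∑ g ∈ s, p ^ #{x ∈ s | g < x} * q ^ #{x ∈ s | x < g} = pqNumber p q #s := by
  induction s using Finset.induction_on_min with
  | empty => simp
  | insert a s ha ih =>
    have has : a ∉ s := fun h => lt_irrefl _ (ha a h)
    rw [sum_insert has, card_insert_of_notMem has, pqNumber_succ, ← ih, mul_sum, add_comm]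
    congr 1
    · refine sum_congr rfl fun g hg => ?_
      rw [filter_insert, filter_insert, if_pos (ha g hg), if_neg (ha g hg).not_gt,
        card_insert_of_notMem (by simp [has])]
      ring
    · rw [filter_insert, filter_insert, if_neg (lt_irrefl a), if_neg (lt_irrefl a),
        filter_eq_empty_iff.mpr (fun x hx => (ha x hx).not_gt), filter_eq_self.mpr ha]
      simp

end DyckPaths

section Insertion

variable {N : ℕ}

/-- The permutation of `Fin (N + 1)` that maps `i` to `v` and is order isomorphic to `τ` on the
remaining positions and values. -/
def insertPoint (i v : Fin (N + 1)) (τ : Equiv.Perm (Fin N)) : Equiv.Perm (Fin (N + 1)) :=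
  (finSuccEquiv' i).trans ((Equiv.optionCongr τ).trans (finSuccEquiv' v).symm)

@[simp] lemma insertPoint_self (i v : Fin (N + 1)) (τ : Equiv.Perm (Fin N)) :
    insertPoint i v τ i = v := by
  simp [insertPoint]

@[simp] lemma insertPoint_succAbove (i v : Fin (N + 1)) (τ : Equiv.Perm (Fin N)) (k : Fin N) :
    insertPoint i v τ (i.succAbove k) = v.succAbove (τ k) := by
  simp [insertPoint]

lemma symm_insertPoint (i v : Fin (N + 1)) (τ : Equiv.Perm (Fin N)) :
    (insertPoint i v τ).symm = insertPoint v i τ.symm :=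
  rfl

lemma insertPoint_bijective (i : Fin (N + 1)) :
    Function.Bijective fun x : Fin (N + 1) × Equiv.Perm (Fin N) => insertPoint i x.1 x.2 := by
  rw [Fintype.bijective_iff_injective_and_card]
  refine ⟨fun ⟨v, τ⟩ ⟨v', τ'⟩ h => ?_, by simp [Fintype.card_perm, Nat.factorial_succ]⟩
  have apply_eq (k : Fin (N + 1)) : insertPoint i v τ k = insertPoint i v' τ' k :=
    congrArg (· k) h
  obtain rfl : v = v' := by simpa using apply_eq i
  obtain rfl : τ = τ' := Equiv.ext fun k => by simpa using apply_eq (i.succAbove k)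
  rfl

lemma sum_perm_eq_sum_value {A : Type*} [AddCommMonoid A] (i : Fin (N + 1))
    (f : Equiv.Perm (Fin (N + 1)) → A) :
    ∑ σ, f σ = ∑ v, ∑ τ, f (insertPoint i v τ) := by
  rw [← Fintype.sum_prod_type' (fun v τ => f (insertPoint i v τ))]
  exact ((insertPoint_bijective i).sum_comp f).symm

lemma sum_perm_eq_sum_position {A : Type*} [AddCommMonoid A] (v : Fin (N + 1))
    (f : Equiv.Perm (Fin (N + 1)) → A) :
    ∑ σ, f σ = ∑ i, ∑ τ, f (insertPoint i v τ) := by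
  rw [← Fintype.sum_equiv (Equiv.inv _) (fun σ => f σ.symm) f fun _ => rfl,
    sum_perm_eq_sum_value v]
  exact sum_congr rfl fun i _ => Fintype.sum_equiv (Equiv.inv _) _ _ fun _ => rfl

lemma val_succAbove (i : Fin (N + 1)) (k : Fin N) :
    (i.succAbove k).val = if k.val < i.val then k.val else k.val + 1 := by
  rw [Fin.succAbove, apply_ite Fin.val]
  rfl

lemma card_filter_succAbove (i : Fin (N + 1)) (P : Fin (N + 1) → Prop) [DecidablePred P] :
    #{x | P x} = (if P i then 1 else 0) + #{k | P (i.succAbove k)} := by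
  simp only [card_filter]
  exact Fin.sum_univ_succAbove _ i

lemma card_filter_pairs_succAbove (i : Fin (N + 1)) (P : Fin (N + 1) × Fin (N + 1) → Prop)
    [DecidablePred P] (hi : ¬ P (i, i)) :
    #{x | P x} = #{x : Fin N × Fin N | P (i.succAbove x.1, i.succAbove x.2)} +
      #{k | P (i, i.succAbove k)} + #{k | P (i.succAbove k, i)} := by
  simp only [card_filter, Fintype.sum_prod_type, Fin.sum_univ_succAbove _ i, hi, if_false,
    sum_add_distrib]
  ring

lemma card_filter_interval {a b : ℕ} (hb : b ≤ N) :
    #{k : Fin N | a ≤ k.val ∧ k.val < b} = b - a := by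
  rw [← Nat.card_Ico, ← card_map Fin.valEmbedding]
  congr 1
  ext x
  simp only [mem_map, mem_filter_univ, Fin.valEmbedding_apply, mem_Ico]
  exact ⟨by rintro ⟨k, hk, rfl⟩; exact hk, fun hx => ⟨⟨x, by omega⟩, hx, rfl⟩⟩

lemma card_filter_apply_interval (τ : Equiv.Perm (Fin N)) {a b : ℕ} (hb : b ≤ N) :
    #{k : Fin N | a ≤ (τ k).val ∧ (τ k).val < b} = b - a := by
  rw [← card_filter_interval hb, ← card_map τ.toEmbedding]
  congr 1
  ext k
  simp

end Insertion

section CrossingsAndNestings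

variable {N : ℕ}

/-- The first `a` positions carry values that are at least `b`. With `b = a` or `b = a - 1`, these
are the permutations that are left when the points whose position and value are both small have
been removed one after the other. -/
def PrefixGE (a b : ℕ) (σ : Equiv.Perm (Fin N)) : Prop :=
  ∀ i : Fin N, i.val < a → b ≤ (σ i).val

instance (a b : ℕ) : DecidablePred (PrefixGE (N := N) a b) :=
  fun _ => inferInstanceAs (Decidable (∀ _, _))

/-- The number of fixed points `i ≥ f`. -/
def fixFrom (f : ℕ) (σ : Equiv.Perm (Fin N)) : ℕ :=
  #{i | f ≤ i.val ∧ σ i = i}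

lemma prefixGE_succ_left_iff {h : Fin N} {b : ℕ} {σ : Equiv.Perm (Fin N)} :
    PrefixGE (h + 1) b σ ↔ PrefixGE h b σ ∧ b ≤ (σ h).val := by
  refine ⟨fun H => ⟨fun i hi => H i (by omega), H h (by omega)⟩, fun H i hi => ?_⟩
  rcases Nat.lt_succ_iff_lt_or_eq.mp hi with hi | hi
  · exact H.1 i hi
  · rw [Fin.ext hi]
    exact H.2

lemma prefixGE_succ_right_iff {h : Fin N} {σ : Equiv.Perm (Fin N)} :
    PrefixGE (h + 1) (h + 1) σ ↔ PrefixGE (h + 1) h σ ∧ h < σ.symm h := by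
  rw [Fin.lt_def]
  refine ⟨fun H => ⟨fun i hi => (Nat.le_succ _).trans (H i hi), ?_⟩, fun H i hi => ?_⟩
  · by_contra hle
    have := H (σ.symm h) (by omega)
    simp at this
  · have hne : σ i ≠ h := by
      rintro rfl
      rw [Equiv.symm_apply_apply] at H
      omega
    have := H.1 i hi
    rw [Ne, Fin.ext_iff] at hne
    omega

lemma fixFrom_eq_fixFrom_succ {h : ℕ} {σ : Equiv.Perm (Fin N)} (H : PrefixGE (h + 1) (h + 1) σ) :
    fixFrom h σ = fixFrom (h + 1) σ := by
  refine congrArg card (filter_congr fun i _ => ?_)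
  have := H i
  rw [Fin.ext_iff]
  omega

section RemovePosition

variable {h v : Fin (N + 1)} {τ : Equiv.Perm (Fin N)}

lemma prefixGE_insertPoint_position (hv : v < h) :
    PrefixGE h h (insertPoint h v τ) ↔ PrefixGE h (h - 1) τ := by
  rw [Fin.lt_def] at hv
  simp only [PrefixGE, Fin.forall_iff_succAbove h, insertPoint_succAbove, insertPoint_self,
    val_succAbove, lt_irrefl, false_imp_iff, true_and]
  refine forall_congr' fun k => ?_
  split_ifs <;> omega

lemma wex_insertPoint_position (hv : v < h) (H : PrefixGE h (h - 1) τ) :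
    wex (insertPoint h v τ) = wex τ := by
  rw [wex, card_filter_succAbove h, insertPoint_self, if_neg hv.not_ge, zero_add]
  refine congrArg card (filter_congr fun k _ => ?_)
  have := H k
  rw [Fin.lt_def] at hv
  rw [insertPoint_succAbove, Fin.le_def, Fin.le_def, val_succAbove, val_succAbove]
  split_ifs <;> omega

lemma fixFrom_insertPoint_position (hv : v < h) :
    fixFrom h (insertPoint h v τ) = fixFrom h τ := by
  rw [fixFrom, card_filter_succAbove h, insertPoint_self, if_neg (fun H => hv.ne H.2), zero_add]
  refine congrArg card (filter_congr fun k _ => ?_)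
  rw [Fin.lt_def] at hv
  rw [insertPoint_succAbove, Fin.ext_iff, Fin.ext_iff, val_succAbove, val_succAbove]
  split_ifs <;> omega

lemma cros_insertPoint_position (hv : v < h) (H : PrefixGE h (h - 1) τ) :
    cros (insertPoint h v τ) = cros τ + (h - 1 - v) := by
  rw [cros, card_filter_pairs_succAbove h, ← add_zero (cros τ), cros,
    ← card_filter_apply_interval τ (by omega : h.val - 1 ≤ N)]
  · simp only [insertPoint_succAbove, insertPoint_self, Fin.lt_def, Fin.le_def, val_succAbove]
    rw [Fin.lt_def] at hv
    refine congrArg₂ _ (congrArg₂ _ (congrArg card (filter_congr fun x _ => ?_))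
      (card_eq_zero.mpr (filter_eq_empty_iff.mpr fun k _ => ?_)))
      (congrArg card (filter_congr fun k _ => ?_))
    · have := H x.1
      have := H x.2
      split_ifs <;> omega
    all_goals
      have := H k
      split_ifs <;> omega
  · simp

lemma nest_insertPoint_position (hv : v < h) (H : PrefixGE h (h - 1) τ) :
    nest (insertPoint h v τ) = nest τ + v := by
  rw [nest, card_filter_pairs_succAbove h, ← add_zero (nest τ), nest,
    ← Nat.sub_zero v.val, ← card_filter_apply_interval τ (by omega : v.val ≤ N)]
  · simp only [insertPoint_succAbove, insertPoint_self, Fin.lt_def, Fin.le_def, val_succAbove]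
    rw [Fin.lt_def] at hv
    refine congrArg₂ _ (congrArg₂ _ (congrArg card (filter_congr fun x _ => ?_))
      (card_eq_zero.mpr (filter_eq_empty_iff.mpr fun k _ => ?_)))
      (congrArg card (filter_congr fun k _ => ?_))
    · have := H x.1
      have := H x.2
      split_ifs <;> omega
    all_goals
      have := H k
      split_ifs <;> omega
  · simp

end RemovePosition

section RemoveValue

variable {h i : Fin (N + 1)} {τ : Equiv.Perm (Fin N)}

lemma prefixGE_insertPoint_value (hi : i ≤ h) :
    PrefixGE (h + 1) h (insertPoint i h τ) ↔ PrefixGE h h τ := by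
  rw [Fin.le_def] at hi
  simp only [PrefixGE, Fin.forall_iff_succAbove i, insertPoint_succAbove, insertPoint_self,
    val_succAbove, le_refl, imp_true_iff, true_and]
  refine forall_congr' fun k => ?_
  split_ifs <;> omega

lemma wex_insertPoint_value (hi : i ≤ h) (H : PrefixGE h h τ) :
    wex (insertPoint i h τ) = wex τ + 1 := by
  rw [wex, card_filter_succAbove i, insertPoint_self, if_pos hi, add_comm]
  refine congrArg (card · + 1) (filter_congr fun k _ => ?_)
  have := H k
  rw [Fin.le_def] at hi
  rw [insertPoint_succAbove, Fin.le_def, Fin.le_def, val_succAbove, val_succAbove]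
  split_ifs <;> omega

lemma fixFrom_insertPoint_value (hi : i ≤ h) :
    fixFrom h (insertPoint i h τ) = (if i = h then 1 else 0) + fixFrom h τ := by
  rw [fixFrom, card_filter_succAbove i, insertPoint_self]
  rw [Fin.le_def] at hi
  refine congrArg₂ _ (if_congr ?_ rfl rfl) (congrArg card (filter_congr fun k _ => ?_))
  · rw [Fin.ext_iff, Fin.ext_iff]
    omega
  · rw [insertPoint_succAbove, Fin.ext_iff, Fin.ext_iff, val_succAbove, val_succAbove]
    split_ifs <;> omega

lemma fixFrom_succ_insertPoint_value (hi : i ≤ h) :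
    fixFrom (h + 1) (insertPoint i h τ) = fixFrom h τ := by
  rw [Fin.le_def] at hi
  rw [fixFrom, card_filter_succAbove i, if_neg (by omega), zero_add]
  refine congrArg card (filter_congr fun k _ => ?_)
  rw [insertPoint_succAbove, Fin.ext_iff, Fin.ext_iff, val_succAbove, val_succAbove]
  split_ifs <;> omega

lemma cros_insertPoint_value (hi : i ≤ h) (H : PrefixGE h h τ) :
    cros (insertPoint i h τ) = cros τ + (h - i) := by
  rw [cros, card_filter_pairs_succAbove i, ← add_zero (cros τ + _), cros,
    ← card_filter_interval (by omega : h.val ≤ N)]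
  · simp only [insertPoint_succAbove, insertPoint_self, Fin.lt_def, Fin.le_def, val_succAbove]
    rw [Fin.le_def] at hi
    refine congrArg₂ _ (congrArg₂ _ (congrArg card (filter_congr fun x _ => ?_))
      (congrArg card (filter_congr fun k _ => ?_)))
      (card_eq_zero.mpr (filter_eq_empty_iff.mpr fun k _ => ?_))
    · have := H x.1
      have := H x.2
      split_ifs <;> omega
    all_goals
      have := H k
      split_ifs <;> omega
  · simp

lemma nest_insertPoint_value (hi : i ≤ h) (H : PrefixGE h h τ) :
    nest (insertPoint i h τ) = nest τ + i := by
  rw [nest, card_filter_pairs_succAbove i, ← add_zero (nest τ), nest,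
    ← Nat.sub_zero i.val, ← card_filter_interval (by omega : i.val ≤ N)]
  · simp only [insertPoint_succAbove, insertPoint_self, Fin.lt_def, Fin.le_def, val_succAbove]
    rw [Fin.le_def] at hi
    refine congrArg₂ _ (congrArg₂ _ (congrArg card (filter_congr fun x _ => ?_))
      (card_eq_zero.mpr (filter_eq_empty_iff.mpr fun k _ => ?_)))
      (congrArg card (filter_congr fun k _ => ?_))
    · have := H x.1
      have := H x.2
      split_ifs <;> omega
    all_goals
      have := H k
      split_ifs <;> omega
  · simp

end RemoveValue

lemma sum_prefixGE_value_lt {A : Type*} [AddCommMonoid A] (h : Fin (N + 1))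
    (F : Equiv.Perm (Fin (N + 1)) → A) :
    ∑ σ with PrefixGE h h σ ∧ σ h < h, F σ =
      ∑ v ∈ Iio h, ∑ τ : Equiv.Perm (Fin N) with PrefixGE h (h - 1) τ, F (insertPoint h v τ) := by
  rw [sum_filter, sum_perm_eq_sum_value h, ← filter_gt_eq_Iio, sum_filter]
  refine sum_congr rfl fun v _ => ?_
  simp only [insertPoint_self]
  split_ifs with hv
  · simp only [prefixGE_insertPoint_position hv, hv, and_true, sum_filter]
  · simp only [hv, and_false, if_false, sum_const_zero]

lemma sum_prefixGE_position_le {A : Type*} [AddCommMonoid A] (h : Fin (N + 1))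
    (F : Equiv.Perm (Fin (N + 1)) → A) :
    ∑ σ with PrefixGE (h + 1) h σ ∧ σ.symm h ≤ h, F σ =
      ∑ i ∈ Iic h, ∑ τ : Equiv.Perm (Fin N) with PrefixGE h h τ, F (insertPoint i h τ) := by
  rw [sum_filter, sum_perm_eq_sum_position h, ← filter_ge_eq_Iic, sum_filter]
  refine sum_congr rfl fun i _ => ?_
  simp only [symm_insertPoint, insertPoint_self]
  split_ifs with hi
  · simp only [prefixGE_insertPoint_value hi, hi, and_true, sum_filter]
  · simp only [hi, and_false, if_false, sum_const_zero]

section PermSum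

variable {R : Type*} [CommSemiring R] (p q y z : R)

/-- The weight of a permutation, where `z` marks the fixed points `i ≥ f`. -/
def permWeight (f : ℕ) (σ : Equiv.Perm (Fin N)) : R :=
  y ^ wex σ * z ^ fixFrom f σ * p ^ nest σ * q ^ cros σ

/-- The total weight of the permutations of `Fin N` whose first `a` values are at least `b`. -/
def permSum (N a b f : ℕ) : R :=
  ∑ σ : Equiv.Perm (Fin N) with PrefixGE a b σ, permWeight p q y z f σ

lemma permSum_remove_position (h : Fin (N + 1)) :
    permSum p q y z (N + 1) h h h =
      permSum p q y z (N + 1) (h + 1) h h + pqNumber p q h * permSum p q y z N h (h - 1) h := by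
  rw [permSum, ← sum_filter_not_add_sum_filter _ fun σ => σ h < h, filter_filter, filter_filter,
    sum_prefixGE_value_lt, ← sum_Iio_eq_pqNumber, sum_mul, permSum]
  congr 1
  · refine sum_congr (filter_congr fun σ _ => ?_) fun _ _ => rfl
    rw [prefixGE_succ_left_iff, not_lt, Fin.le_def]
  · refine sum_congr rfl fun v hv => ?_
    rw [mem_Iio] at hv
    rw [permSum, mul_sum]
    refine sum_congr rfl fun τ hτ => ?_
    rw [mem_filter_univ] at hτ
    rw [permWeight, permWeight, wex_insertPoint_position hv hτ, fixFrom_insertPoint_position hv,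
      nest_insertPoint_position hv hτ, cros_insertPoint_position hv hτ]
    ring

lemma permSum_remove_value (h : Fin (N + 1)) (f : ℕ) (e : Fin (N + 1) → ℕ)
    (he : ∀ i ≤ h, ∀ τ : Equiv.Perm (Fin N), fixFrom f (insertPoint i h τ) = e i + fixFrom h τ) :
    permSum p q y z (N + 1) (h + 1) h f = permSum p q y z (N + 1) (h + 1) (h + 1) f +
      y * (∑ i ∈ Iic h, z ^ e i * (p ^ i.val * q ^ (h.val - i.val))) *
        permSum p q y z N h h h := by
  rw [permSum, ← sum_filter_not_add_sum_filter _ fun σ => σ.symm h ≤ h, filter_filter,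
    filter_filter, sum_prefixGE_position_le, permSum, mul_sum, sum_mul]
  congr 1
  · simp only [not_le, prefixGE_succ_right_iff]
  · refine sum_congr rfl fun i hi => ?_
    rw [mem_Iic] at hi
    rw [permSum, mul_sum]
    refine sum_congr rfl fun τ hτ => ?_
    rw [mem_filter_univ] at hτ
    rw [permWeight, permWeight, wex_insertPoint_value hi hτ, he i hi, nest_insertPoint_value hi hτ,
      cros_insertPoint_value hi hτ]
    ring

lemma permSum_remove_value_succ (h : Fin (N + 1)) :
    permSum p q y z (N + 1) (h + 1) h (h + 1) = permSum p q y z (N + 1) (h + 1) (h + 1) (h + 1) +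
      y * pqNumber p q (h + 1) * permSum p q y z N h h h := by
  rw [permSum_remove_value p q y z h (h + 1) (fun _ => 0)
    fun i hi τ => by rw [fixFrom_succ_insertPoint_value hi, zero_add]]
  simp only [pow_zero, one_mul, sum_Iic_eq_pqNumber]

lemma permSum_remove_value_self (h : Fin (N + 1)) :
    permSum p q y z (N + 1) (h + 1) h h = permSum p q y z (N + 1) (h + 1) (h + 1) (h + 1) +
      y * (q * pqNumber p q h + z * p ^ h.val) * permSum p q y z N h h h := by
  have weights : ∑ i ∈ Iic h, z ^ (if i = h then 1 else 0) * (p ^ i.val * q ^ (h.val - i.val)) =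
      q * pqNumber p q h + z * p ^ h.val := by
    rw [← Iio_insert, sum_insert (by simp), ← sum_Iio_eq_pqNumber, mul_sum, add_comm]
    congr 1
    · refine sum_congr rfl fun i hi => ?_
      rw [mem_Iio] at hi
      rw [if_neg hi.ne, mul_left_comm q, ← pow_succ', Nat.sub_right_comm,
        Nat.sub_add_cancel (Nat.sub_pos_of_lt hi), pow_zero, one_mul]
    · simp
  rw [permSum_remove_value p q y z h h _ fun i hi τ => fixFrom_insertPoint_value hi, weights]
  congr 1
  refine sum_congr rfl fun σ hσ => ?_
  rw [permWeight, permWeight, fixFrom_eq_fixFrom_succ (mem_filter_univ _ |>.mp hσ)]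

lemma permSum_zero_zero (N f : ℕ) :
    permSum p q y z N 0 0 f = ∑ σ : Equiv.Perm (Fin N), permWeight p q y z f σ := by
  rw [permSum, filter_true_of_mem]
  exact fun σ _ i hi => absurd hi (Nat.not_lt_zero _)

/-- The total weight of the permutations of `Fin (r + h)` whose first `h` values are at least `h`.
Such a permutation is what is left of a larger one when the points whose position and value both
lie below some level have been removed: `r` positions lie at or above that level, and `h` positions
and `h` values below it still wait for a partner at or above it. -/
def diagSum (r h : ℕ) : R := permSum p q y z (r + h) h h h

/-- The total weight of the permutations of `Fin (r + 1 + h)` whose first `h + 1` values are at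
least `h`. It occurs in the recursion for `diagSum` once a position has been removed without
the corresponding value. -/
def offDiagSum (r h : ℕ) : R := permSum p q y z (r + 1 + h) (h + 1) h (h + 1)

lemma diagSum_zero_zero : diagSum p q y z 0 0 = 1 := by
  simp [diagSum, permSum_zero_zero, permWeight, wex, fixFrom, nest, cros]

lemma diagSum_zero_succ (h : ℕ) : diagSum p q y z 0 (h + 1) = 0 := by
  rw [diagSum, permSum, zero_add, filter_eq_empty_iff.mpr, sum_empty]
  exact fun σ _ H => absurd (H (σ.symm 0) (σ.symm 0).is_lt) (by simp)

lemma offDiagSum_eq (r h : ℕ) : offDiagSum p q y z r h =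
    diagSum p q y z r (h + 1) + y * pqNumber p q (h + 1) * diagSum p q y z r h := by
  have := permSum_remove_value_succ p q y z (⟨h, by omega⟩ : Fin (r + h + 1))
  rw [offDiagSum, diagSum, diagSum, add_right_comm]
  exact this

lemma diagSum_succ (r h : ℕ) : diagSum p q y z (r + 1) h =
    diagSum p q y z r (h + 1) + y * (q * pqNumber p q h + z * p ^ h) * diagSum p q y z r h +
      pqNumber p q h * offDiagSum p q y z r (h - 1) := by
  have remove_position := permSum_remove_position p q y z (⟨h, by omega⟩ : Fin (r + h + 1))
  rw [permSum_remove_value_self] at remove_position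
  rw [diagSum, add_right_comm, remove_position]
  congr 1
  cases h with
  | zero => simp
  | succ h =>
    rw [offDiagSum, Nat.add_sub_cancel, add_right_comm r 1 h]
    rfl

end PermSum

section Evaluation

variable {R : Type*} [CommRing R] (p q : R)

lemma diagSum_zero_eq_dyckSum {u : R} (huq : u * q = -1) (r h : ℕ) :
    diagSum p q u 0 r h =
      dyckSum 1 (fun k => u * (pqNumber p q (k + 1) * pqNumber p q (k + 1))) r h := by
  rw [← one_mul (dyckSum _ _ _ _)]
  refine eq_mul_dyckSum 1 (diagSum_zero_zero ..) (diagSum_zero_succ p q u 0) (fun r => ?_)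
    (fun r h => ?_) r h
  · simp [diagSum_succ]
  · rw [diagSum_succ, Nat.add_sub_cancel, offDiagSum_eq, Pi.one_apply]
    linear_combination pqNumber p q (h + 1) * diagSum p q u 0 r (h + 1) * huq

lemma diagSum_neg_one_one_succ (r h : ℕ) : diagSum p q (-1) 1 (r + 1) h =
    offDiagSum p q (-1) 1 r h + pqNumber p q h * offDiagSum p q (-1) 1 r (h - 1) := by
  rw [diagSum_succ, offDiagSum_eq p q _ _ r h, pqNumber_succ, one_mul]

lemma offDiagSum_neg_one_one_eq_dyckSum (r h : ℕ) : offDiagSum p q (-1) 1 r h =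
    -dyckSum 1 (fun k => -1 * (pqNumber p q (k + 1) * pqNumber p q (k + 2))) r h := by
  rw [← neg_one_mul (dyckSum _ _ _ _)]
  refine eq_mul_dyckSum (-1) ?_ (fun h => ?_) (fun r => ?_) (fun r h => ?_) r h
  · simp [offDiagSum_eq, diagSum_zero_zero, diagSum_zero_succ]
  · simp [offDiagSum_eq, diagSum_zero_succ]
  · simp [offDiagSum_eq _ _ _ _ (r + 1), diagSum_neg_one_one_succ]
  · rw [offDiagSum_eq, diagSum_neg_one_one_succ, diagSum_neg_one_one_succ, Nat.add_sub_cancel,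
      Nat.add_sub_cancel, Pi.one_apply]
    ring

lemma sum_perm_neg_one_pow_wex_eq_dyckSum (r : ℕ) :
    ∑ σ : Equiv.Perm (Fin (r + 1)), (-1) ^ wex σ * p ^ nest σ * q ^ cros σ =
      -dyckSum 1 (fun k => -1 * (pqNumber p q (k + 1) * pqNumber p q (k + 2))) r 0 := by
  rw [← offDiagSum_neg_one_one_eq_dyckSum]
  have := diagSum_neg_one_one_succ p q r 0
  rw [pqNumber_zero, zero_mul, add_zero] at this
  rw [← this, diagSum, permSum_zero_zero]
  simp only [permWeight, one_pow, mul_one]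

lemma wex_eq_exc_of_mem_derangements {n : ℕ} {σ : Equiv.Perm (Fin n)}
    (hσ : σ ∈ derangements (Fin n)) : wex σ = exc σ :=
  congrArg card (filter_congr fun i _ => ⟨fun hi => hi.lt_of_ne' (hσ i), le_of_lt⟩)

lemma fixFrom_zero_eq_zero_iff {n : ℕ} {σ : Equiv.Perm (Fin n)} :
    fixFrom 0 σ = 0 ↔ σ ∈ derangements (Fin n) := by
  simp [fixFrom, filter_eq_empty_iff, derangements]

lemma sum_derangements_eq_dyckSum {u : R} (huq : u * q = -1) (n : ℕ) :
    ∑ σ : derangements (Fin n), u ^ exc σ.val * p ^ nest σ.val * q ^ cros σ.val =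
      dyckSum 1 (fun k => u * (pqNumber p q (k + 1) * pqNumber p q (k + 1))) n 0 := by
  rw [← diagSum_zero_eq_dyckSum p q huq, diagSum, permSum_zero_zero]
  refine Fintype.sum_of_injective Subtype.val Subtype.val_injective _ _ (fun σ hσ => ?_)
    fun σ => ?_
  · have hfix : fixFrom 0 σ ≠ 0 := fixFrom_zero_eq_zero_iff.not.mpr (by simpa using hσ)
    rw [permWeight, zero_pow hfix, mul_zero, zero_mul, zero_mul]
  · rw [permWeight, fixFrom_zero_eq_zero_iff.mpr σ.2, wex_eq_exc_of_mem_derangements σ.2, pow_zero,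
      mul_one]

end Evaluation

end CrossingsAndNestings

section MarkedPermutations

variable {N : ℕ}

/-- Gap `g` of a word of length `N`, lying between the letters `g - 1` and `g`, is adjacent to
letter `k`. -/
def Touches (g : Fin (N + 1)) (k : Fin N) : Prop := g.val = k.val ∨ g.val = k.val + 1

instance (g : Fin (N + 1)) : DecidablePred (Touches g) :=
  fun _ => inferInstanceAs (Decidable (_ ∨ _))

/-- The gaps of a word that are not adjacent to a marked letter. -/
def gaps (c : Fin N → Bool) : Finset (Fin (N + 1)) := {g | ∀ k, c k → ¬ Touches g k}

/-- The ends of a word at which a smaller letter may not become a marked letter: always the left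
end, and the right end if `e` holds. -/
def ends (e : Bool) (N : ℕ) : Finset (Fin (N + 1)) := if e then {0, Fin.last N} else {0}

/-- The gaps in which a marked letter may be inserted. -/
def innerGaps (e : Bool) (c : Fin N → Bool) : Finset (Fin (N + 1)) := gaps c \ ends e N

/-- The gaps in which a letter with mark `b` may be inserted. -/
def slots (e b : Bool) (c : Fin N → Bool) : Finset (Fin (N + 1)) :=
  if b then innerGaps e c else gaps c

lemma slots_subset_gaps {e b : Bool} {c : Fin N → Bool} : slots e b c ⊆ gaps c := by
  cases b
  · exact Subset.rfl
  · exact sdiff_subset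

/-- The marked letters of the word `σ` are valleys, and there is none at the left end, nor at the
right end if `e` holds. -/
def IsMarked (e : Bool) (σ : Equiv.Perm (Fin N)) (c : Fin N → Bool) : Prop :=
  (∀ i j, c i → (i.val + 1 = j.val ∨ j.val + 1 = i.val) → σ i < σ j) ∧ ends e N ⊆ gaps c

instance (e : Bool) (σ : Equiv.Perm (Fin N)) : DecidablePred (IsMarked e σ) :=
  fun _ => inferInstanceAs (Decidable (_ ∧ _))

/-- The gap to the left of letter `i` if `e` holds, and to its right otherwise. -/
def sideGap (e : Bool) (i : Fin N) : Fin (N + 1) := if e then i.castSucc else i.succ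

lemma val_sideGap (e : Bool) (i : Fin N) :
    (sideGap e i).val = if e then i.val else i.val + 1 := by
  cases e <;> rfl

lemma sideGap_succAbove (e : Bool) (g : Fin (N + 1)) (i : Fin N) :
    sideGap e (g.succAbove i) = (sideGap e g).succAbove (sideGap e i) := by
  rw [Fin.ext_iff]
  cases e <;> simp only [val_sideGap, val_succAbove] <;> split_ifs <;> grind

lemma touches_succAbove (e : Bool) {g : Fin (N + 1)} {k : Fin N} (hk : ¬ Touches g k)
    (g' : Fin (N + 1)) :
    Touches ((sideGap e g).succAbove g') (g.succAbove k) ↔ Touches g' k := by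
  simp only [Touches, val_succAbove, val_sideGap] at hk ⊢
  cases e <;> grind

lemma touches_sideGap_self (e : Bool) (i : Fin N) : Touches (sideGap e i) i := by
  cases e <;> simp [sideGap, Touches]

section Insert

variable {e b : Bool} {g : Fin (N + 1)} {c : Fin N → Bool} {τ : Equiv.Perm (Fin N)}

lemma sideGap_mem_gaps_insertNth (e : Bool) (hg : g ∈ gaps c) :
    sideGap e g ∈ gaps (g.insertNth b c) ↔ ¬ b := by
  rw [gaps, mem_filter_univ] at hg ⊢
  simp only [Fin.forall_iff_succAbove g, Fin.insertNth_apply_same, Fin.insertNth_apply_succAbove,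
    touches_sideGap_self, not_true, imp_false, and_iff_left_iff_imp]
  intro _ k hk
  have := hg k hk
  simp only [Touches, val_succAbove, val_sideGap] at this ⊢
  cases e <;> grind

lemma succAbove_mem_gaps_insertNth (e : Bool) (hg : g ∈ gaps c) (g' : Fin (N + 1)) :
    (sideGap e g).succAbove g' ∈ gaps (g.insertNth b c) ↔ g' ∈ gaps c ∧ (b → g' ≠ g) := by
  rw [gaps, mem_filter_univ] at hg
  simp only [gaps, mem_filter_univ, Fin.forall_iff_succAbove g, Fin.insertNth_apply_same,
    Fin.insertNth_apply_succAbove]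
  rw [and_comm]
  refine and_congr (forall_congr' fun k => forall_congr' fun hk => ?_)
    (forall_congr' fun _ => not_congr ?_)
  · rw [touches_succAbove e (hg k hk)]
  · rw [Fin.ext_iff]
    simp only [Touches, val_succAbove, val_sideGap]
    cases e <;> grind

lemma ends_subset_iff {e : Bool} {s : Finset (Fin (N + 1))} :
    ends e N ⊆ s ↔ 0 ∈ s ∧ (e → Fin.last N ∈ s) := by
  cases e <;> simp [ends, insert_subset_iff]

lemma mem_ends {e : Bool} {g : Fin (N + 1)} : g ∈ ends e N ↔ g = 0 ∨ (e ∧ g = Fin.last N) := by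
  cases e <;> simp [ends]

lemma mem_slots {e b : Bool} {c : Fin N → Bool} {g : Fin (N + 1)} :
    g ∈ slots e b c ↔ g ∈ gaps c ∧ (b → g ≠ 0 ∧ (e → g ≠ Fin.last N)) := by
  cases b <;> simp [slots, innerGaps, mem_ends]

lemma zero_mem_gaps_insertNth (hg : g ∈ gaps c) :
    0 ∈ gaps (g.insertNth b c) ↔ 0 ∈ gaps c ∧ (b → 0 ≠ g) := by
  rw [← succAbove_mem_gaps_insertNth false hg 0]
  rfl

lemma last_mem_gaps_insertNth (hg : g ∈ gaps c) :
    Fin.last (N + 1) ∈ gaps (g.insertNth b c) ↔ Fin.last N ∈ gaps c ∧ (b → Fin.last N ≠ g) := by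
  rw [← succAbove_mem_gaps_insertNth true hg (Fin.last N)]
  simp [sideGap]

lemma touches_iff_adjacent {k : Fin N} :
    Touches g k ↔ (g.succAbove k).val + 1 = g.val ∨ g.val + 1 = (g.succAbove k).val := by
  rw [Touches, val_succAbove]
  grind

lemma adjacent_succAbove_iff {k l : Fin N} (hk : ¬ Touches g k) :
    ((g.succAbove k).val + 1 = (g.succAbove l).val ∨
        (g.succAbove l).val + 1 = (g.succAbove k).val) ↔
      k.val + 1 = l.val ∨ l.val + 1 = k.val := by
  rw [Touches] at hk
  rw [val_succAbove, val_succAbove]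
  grind

lemma valleys_insertPoint_iff :
    (∀ i j, (g.insertNth b c : Fin (N + 1) → Bool) i →
        (i.val + 1 = j.val ∨ j.val + 1 = i.val) → insertPoint g 0 τ i < insertPoint g 0 τ j) ↔
      (∀ i j, c i → (i.val + 1 = j.val ∨ j.val + 1 = i.val) → τ i < τ j) ∧ g ∈ gaps c := by
  simp only [Fin.forall_iff_succAbove g, Fin.insertNth_apply_same, Fin.insertNth_apply_succAbove,
    insertPoint_self, insertPoint_succAbove, Fin.zero_succAbove, Fin.succ_lt_succ_iff,
    Fin.succ_pos, Fin.not_lt_zero, imp_true_iff, imp_false, and_true, gaps, mem_filter_univ,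
    (Nat.succ_ne_self _), or_self, not_false_iff, true_and, ← touches_iff_adjacent,
    ← forall_and]
  refine forall_congr' fun k => ?_
  rw [and_comm]
  refine and_congr_left fun hk => forall_congr' fun l => imp_congr_right fun ck => ?_
  rw [adjacent_succAbove_iff (hk ck)]

lemma isMarked_insertPoint :
    IsMarked e (insertPoint g 0 τ) (g.insertNth b c) ↔ IsMarked e τ c ∧ g ∈ slots e b c := by
  rw [IsMarked, IsMarked, valleys_insertPoint_iff, and_assoc, and_assoc]
  refine and_congr_right fun _ => ?_
  by_cases hg : g ∈ gaps c
  · rw [ends_subset_iff, ends_subset_iff, zero_mem_gaps_insertNth hg, last_mem_gaps_insertNth hg]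
    grind [mem_slots]
  · simp only [mem_slots, hg, ends_subset_iff, false_and, and_false]

lemma card_gaps_insertNth (hg : g ∈ gaps c) :
    #(gaps (g.insertNth b c)) + (if b then 1 else 0) = #(gaps c) + (if b then 0 else 1) := by
  have split := card_filter_succAbove (sideGap true g) (· ∈ gaps (g.insertNth b c))
  simp only [sideGap_mem_gaps_insertNth _ hg, succAbove_mem_gaps_insertNth _ hg,
    filter_univ_mem] at split
  rw [split]
  cases b
  · simp [add_comm]
  · simp [← filter_filter, filter_ne', card_erase_add_one hg]

lemma card_ends (hN : e.toNat ≤ N) : #(ends e N) = 1 + e.toNat := by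
  cases e
  · rfl
  · exact card_pair (Fin.ext_iff.not.mpr (Nat.ne_of_lt hN))

lemma card_innerGaps (hN : e.toNat ≤ N) (hc : ends e N ⊆ gaps c) :
    #(innerGaps e c) + (1 + e.toNat) = #(gaps c) := by
  rw [innerGaps, ← card_ends hN, card_sdiff_add_card_eq_card hc]

lemma card_innerGaps_insertNth (hN : e.toNat ≤ N) (h : IsMarked e τ c) (hg : g ∈ slots e b c) :
    #(innerGaps e (g.insertNth b c)) + (if b then 1 else 0) =
      #(innerGaps e c) + (if b then 0 else 1) := by
  have new := card_innerGaps (by omega) (isMarked_insertPoint.mpr ⟨h, hg⟩).2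
  have old := card_innerGaps hN h.2
  have := card_gaps_insertNth (b := b) (slots_subset_gaps hg)
  omega

/-- Entry `x` is smaller than letter `i` but larger than the marked letter next to `i` on the side
selected by `e`, if there is one. As a marked letter touches its own side gap, `i` is unmarked. -/
def Straddles (e : Bool) (σ : Equiv.Perm (Fin N)) (c : Fin N → Bool) (i x : Fin N) : Prop :=
  x < σ i ∧ ∀ k, c k → Touches (sideGap e i) k → σ k < x

instance (e : Bool) (σ : Equiv.Perm (Fin N)) (c : Fin N → Bool) (i : Fin N) :
    DecidablePred (Straddles e σ c i) :=
  fun _ => inferInstanceAs (Decidable (_ ∧ _))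

/-- The number of letters straddled by an earlier letter, on its right. -/
def leftCount (σ : Equiv.Perm (Fin N)) (c : Fin N → Bool) : ℕ :=
  #{x : Fin N × Fin N | x.1 < x.2 ∧ Straddles false σ c x.1 (σ x.2)}

/-- The number of letters straddled by a later letter, on the side selected by `e`. -/
def rightCount (e : Bool) (σ : Equiv.Perm (Fin N)) (c : Fin N → Bool) : ℕ :=
  #{x : Fin N × Fin N | x.2 < x.1 ∧ Straddles e σ c x.1 (σ x.2)}

lemma not_straddles_insertPoint_self (x : Fin (N + 1)) :
    ¬ Straddles e (insertPoint g 0 τ) (g.insertNth b c) g x := by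
  simp [Straddles]

lemma straddles_insertPoint_succ (hg : g ∈ gaps c) (i x : Fin N) :
    Straddles e (insertPoint g 0 τ) (g.insertNth b c) (g.succAbove i) x.succ ↔
      Straddles e τ c i x := by
  rw [gaps, mem_filter_univ] at hg
  simp only [Straddles, Fin.forall_iff_succAbove g, insertPoint_self, insertPoint_succAbove,
    Fin.zero_succAbove, Fin.succ_lt_succ_iff, Fin.succ_pos, imp_true_iff, true_and,
    Fin.insertNth_apply_succAbove, sideGap_succAbove]
  refine and_congr_right fun _ => forall_congr' fun k => forall_congr' fun hk => ?_
  rw [touches_succAbove e (hg k hk)]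

lemma straddles_insertPoint_zero (hg : g ∈ gaps c) (i : Fin N) :
    Straddles e (insertPoint g 0 τ) (g.insertNth b c) (g.succAbove i) 0 ↔
      sideGap e i ∈ gaps c ∧ (b → sideGap e i ≠ g) := by
  rw [← succAbove_mem_gaps_insertNth e hg, ← sideGap_succAbove, gaps, mem_filter_univ]
  simp [Straddles]

lemma card_filter_Ioc_eq_card_filter_Ico {α : Type*} [LinearOrder α] {s : Finset α} {x y : α}
    (hx : x ∈ s) (hy : y ∈ s) (hxy : x ≤ y) :
    #{a ∈ s | x < a ∧ a ≤ y} = #{a ∈ s | x ≤ a ∧ a < y} := by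
  have Ioc : {a ∈ s | x < a ∧ a ≤ y} = {a ∈ s | x ≤ a ∧ a ≤ y}.erase x := by grind
  have Ico : {a ∈ s | x ≤ a ∧ a < y} = {a ∈ s | x ≤ a ∧ a ≤ y}.erase y := by grind
  rw [Ioc, Ico, card_erase_of_mem (by simp [hx, hxy]), card_erase_of_mem (by simp [hy, hxy])]

lemma card_filter_sideGap (P : Fin (N + 1) → Prop) [DecidablePred P] :
    #{k | P (sideGap e k)} = #{g' | P g' ∧ g' ≠ if e then Fin.last N else 0} := by
  cases e
  · simp [card_filter_succAbove 0 fun g' => P g' ∧ g' ≠ _, sideGap]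
  · simp [card_filter_succAbove (Fin.last N) fun g' => P g' ∧ g' ≠ _, sideGap, Fin.castSucc_ne_last]

lemma card_slots_lt (h0 : 0 ∈ gaps c) (hg : g ∈ slots e b c) :
    #{k | g.succAbove k < g ∧ sideGap false k ∈ gaps c ∧ (b → sideGap false k ≠ g)} =
      #{g' ∈ slots e b c | g' < g} := by
  have left (k : Fin N) : g.succAbove k < g ↔ sideGap false k ≤ g := by
    rw [Fin.lt_def, Fin.le_def, val_succAbove, val_sideGap]
    grind
  simp only [left, card_filter_sideGap fun g' => g' ≤ g ∧ g' ∈ gaps c ∧ (b → g' ≠ g)]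
  cases b
  · convert card_filter_Ioc_eq_card_filter_Ico h0 hg (Fin.zero_le g) using 2 <;> ext g' <;>
      simp only [mem_filter, mem_slots, Fin.pos_iff_ne_zero, Fin.zero_le] <;>
      grind
  · congr 1
    ext g'
    simp only [mem_filter, mem_slots] at hg ⊢
    grind [Fin.le_last]

lemma card_slots_gt (hc : ends e N ⊆ gaps c) (hg : g ∈ slots e b c) :
    #{k | g < g.succAbove k ∧ sideGap e k ∈ gaps c ∧ (b → sideGap e k ≠ g)} =
      #{g' ∈ slots e b c | g < g'} := by
  have right (k : Fin N) : g < g.succAbove k ↔ if e then g ≤ sideGap e k else g < sideGap e k := by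
    rw [Fin.lt_def, Fin.lt_def, Fin.le_def, val_succAbove, val_sideGap]
    grind
  simp only [right, card_filter_sideGap fun g' =>
    (if e then g ≤ g' else g < g') ∧ g' ∈ gaps c ∧ (b → g' ≠ g)]
  rw [ends_subset_iff] at hc
  by_cases h : e ∧ ¬ b
  · obtain ⟨rfl, b_eq⟩ := h
    obtain rfl : b = false := by simpa using b_eq
    convert (card_filter_Ioc_eq_card_filter_Ico hg (hc.2 rfl) (Fin.le_last g)).symm using 2 <;>
      ext g' <;>
      simp only [mem_filter, mem_slots, Fin.lt_last_iff_ne_last, Fin.le_last] <;>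
      grind
  · congr 1
    ext g'
    simp only [mem_filter, mem_slots] at hg ⊢
    grind [Fin.le_last, Fin.zero_le, Fin.not_lt_zero]

lemma leftCount_insertPoint (h0 : 0 ∈ gaps c) (hg : g ∈ slots e b c) :
    leftCount (insertPoint g 0 τ) (g.insertNth b c) =
      leftCount τ c + #{g' ∈ slots e b c | g' < g} := by
  have hg' := slots_subset_gaps hg
  rw [leftCount, card_filter_pairs_succAbove g]
  · simp only [insertPoint_self, insertPoint_succAbove, Fin.zero_succAbove,
      straddles_insertPoint_succ hg', straddles_insertPoint_zero hg',
      not_straddles_insertPoint_self, Fin.succAbove_lt_succAbove_iff, and_false, filter_false,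
      card_empty, add_zero]
    rw [leftCount, card_slots_lt h0 hg]
  · simp

lemma rightCount_insertPoint (hc : ends e N ⊆ gaps c) (hg : g ∈ slots e b c) :
    rightCount e (insertPoint g 0 τ) (g.insertNth b c) =
      rightCount e τ c + #{g' ∈ slots e b c | g < g'} := by
  have hg' := slots_subset_gaps hg
  rw [rightCount, card_filter_pairs_succAbove g]
  · simp only [insertPoint_self, insertPoint_succAbove, Fin.zero_succAbove,
      straddles_insertPoint_succ hg', straddles_insertPoint_zero hg',
      not_straddles_insertPoint_self, Fin.succAbove_lt_succAbove_iff, and_false, filter_false,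
      card_empty, add_zero]
    rw [rightCount, card_slots_gt hc hg]
  · simp

end Insert

section MarkedSum

variable {R : Type*} [CommSemiring R] (p q : R) (e : Bool)

/-- The weight of a marked permutation, which for an alternating permutation with all its valleys
marked becomes the weight by occurrences of vincular patterns. -/
def markedWeight (σ : Equiv.Perm (Fin N)) (c : Fin N → Bool) : R :=
  p ^ rightCount e σ c * q ^ leftCount σ c

/-- The total weight of the marked permutations of `Fin N` with `h` inner gaps. -/
def markedSum (N h : ℕ) : R :=
  ∑ x : Equiv.Perm (Fin N) × (Fin N → Bool) with IsMarked e x.1 x.2 ∧ #(innerGaps e x.2) = h,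
    markedWeight p q e x.1 x.2

lemma sum_marked_eq_sum_insertPoint {A : Type*} [AddCommMonoid A]
    (F : Equiv.Perm (Fin (N + 1)) × (Fin (N + 1) → Bool) → A) :
    ∑ x, F x = ∑ b, ∑ x : Equiv.Perm (Fin N) × (Fin N → Bool), ∑ g,
      F (insertPoint g 0 x.1, Fin.insertNth g b x.2) := by
  have insert (f : (Fin (N + 1) → Bool) → A) (g : Fin (N + 1)) :
      ∑ c, f c = ∑ b, ∑ c : Fin N → Bool, f (Fin.insertNth g b c) := by
    rw [← (Fin.insertNthEquiv (fun _ => Bool) g).sum_comp, Fintype.sum_prod_type]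
    rfl
  simp only [Fintype.sum_prod_type]
  rw [sum_perm_eq_sum_position 0, sum_comm, sum_comm (s := univ (α := Bool))]
  refine sum_congr rfl fun τ _ => ?_
  simp only [fun g => insert (fun c => F (insertPoint g 0 τ, c)) g]
  rw [sum_comm]
  exact sum_congr rfl fun b _ => sum_comm

variable {e} in
lemma sum_slots_markedWeight (b : Bool) {τ : Equiv.Perm (Fin N)} {c : Fin N → Bool}
    (h : IsMarked e τ c) :
    ∑ g ∈ slots e b c, markedWeight p q e (insertPoint g 0 τ) (g.insertNth b c) =
      pqNumber p q #(slots e b c) * markedWeight p q e τ c := by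
  rw [← sum_rank_eq_pqNumber, sum_mul]
  refine sum_congr rfl fun g hg => ?_
  rw [markedWeight, markedWeight, leftCount_insertPoint (ends_subset_iff.mp h.2).1 hg,
    rightCount_insertPoint h.2 hg]
  ring

lemma markedSum_succ_eq (hN : e.toNat ≤ N) (h : ℕ) :
    markedSum p q e (N + 1) h = ∑ b : Bool,
      ∑ x : Equiv.Perm (Fin N) × (Fin N → Bool) with
          IsMarked e x.1 x.2 ∧ #(innerGaps e x.2) + (if b then 0 else 1) = h + if b then 1 else 0,
        pqNumber p q #(slots e b x.2) * markedWeight p q e x.1 x.2 := by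
  rw [markedSum, sum_filter, sum_marked_eq_sum_insertPoint]
  refine sum_congr rfl fun b _ => ?_
  rw [sum_filter]
  refine sum_congr rfl fun x _ => ?_
  simp only [isMarked_insertPoint]
  by_cases hx : IsMarked e x.1 x.2
  · have count : ∀ g ∈ slots e b x.2, #(innerGaps e (g.insertNth b x.2)) = h ↔
        #(innerGaps e x.2) + (if b then 0 else 1) = h + if b then 1 else 0 := fun g hg => by
      rw [← card_innerGaps_insertNth hN hx hg, Nat.add_right_cancel_iff]
    rw [← sum_slots_markedWeight p q b hx]
    simp only [hx, true_and, ite_and, sum_ite_mem, univ_inter]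
    rw [sum_congr rfl fun g hg => if_congr (count g hg) rfl rfl, sum_ite_irrel, sum_const_zero]
  · simp only [hx, false_and, if_false, sum_const_zero]

lemma sum_unmarked (hN : e.toNat ≤ N) (h : ℕ) :
    ∑ x : Equiv.Perm (Fin N) × (Fin N → Bool) with
        IsMarked e x.1 x.2 ∧ #(innerGaps e x.2) = h,
      pqNumber p q #(slots e false x.2) * markedWeight p q e x.1 x.2 =
    pqNumber p q (h + 1 + e.toNat) * markedSum p q e N h := by
  rw [markedSum, mul_sum]
  refine sum_congr rfl fun x hx => ?_
  obtain ⟨marked, rfl⟩ := (mem_filter_univ _).mp hx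
  rw [add_assoc, card_innerGaps hN marked.2]
  rfl

lemma sum_new_mark (h : ℕ) :
    ∑ x : Equiv.Perm (Fin N) × (Fin N → Bool) with
        IsMarked e x.1 x.2 ∧ #(innerGaps e x.2) = h,
      pqNumber p q #(slots e true x.2) * markedWeight p q e x.1 x.2 =
    pqNumber p q h * markedSum p q e N h := by
  rw [markedSum, mul_sum]
  refine sum_congr rfl fun x hx => ?_
  obtain ⟨-, rfl⟩ := (mem_filter_univ _).mp hx
  rfl

lemma markedSum_succ_zero (hN : e.toNat ≤ N) :
    markedSum p q e (N + 1) 0 = pqNumber p q 1 * markedSum p q e N 1 := by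
  simp [markedSum_succ_eq p q e hN, sum_new_mark]

lemma markedSum_succ_succ (hN : e.toNat ≤ N) (h : ℕ) :
    markedSum p q e (N + 1) (h + 1) = pqNumber p q (h + 2) * markedSum p q e N (h + 2) +
      pqNumber p q (h + 1 + e.toNat) * markedSum p q e N h := by
  simp [markedSum_succ_eq p q e hN, sum_new_mark, sum_unmarked p q e hN]

lemma isMarked_toNat_iff (x : Equiv.Perm (Fin e.toNat) × (Fin e.toNat → Bool)) :
    IsMarked e x.1 x.2 ↔ x = (1, fun _ => false) := by
  revert x
  cases e <;> decide

lemma markedSum_toNat (h : ℕ) : markedSum p q e e.toNat h = if h = 0 then 1 else 0 := by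
  have weight : markedWeight p q e (1 : Equiv.Perm (Fin e.toNat)) (fun _ => false) = 1 := by
    have right : rightCount e (1 : Equiv.Perm (Fin e.toNat)) (fun _ => false) = 0 := by
      cases e <;> decide
    have left : leftCount (1 : Equiv.Perm (Fin e.toNat)) (fun _ => false) = 0 := by
      cases e <;> decide
    rw [markedWeight, right, left, pow_zero, pow_zero, one_mul]
  have inner : #(innerGaps e fun _ : Fin e.toNat => false) = 0 := by
    cases e <;> decide
  simp only [markedSum, isMarked_toNat_iff, sum_filter, ite_and, Fintype.sum_ite_eq', inner, weight,
    eq_comm (b := h)]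

lemma markedSum_eq_dyckSum (r h : ℕ) : markedSum p q e (r + e.toNat) h =
    dyckSum (fun k => pqNumber p q (k + 1)) (fun k => pqNumber p q (k + 1 + e.toNat)) r h := by
  rw [← one_mul (dyckSum _ _ _ _)]
  refine eq_mul_dyckSum (M := fun r h => markedSum p q e (r + e.toNat) h) 1 ?_ (fun h => ?_)
    (fun r => ?_) (fun r h => ?_) r h
  · simp [markedSum_toNat]
  · simp [markedSum_toNat]
  · simp only [add_right_comm r 1, markedSum_succ_zero p q e (Nat.le_add_left _ _)]
  · simp only [add_right_comm r 1, markedSum_succ_succ p q e (Nat.le_add_left _ _)]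

end MarkedSum

section Alternating

/-- The marking of every second letter, from the second one on. -/
def oddMarks (N : ℕ) : Fin N → Bool := fun i => decide (i.val % 2 = 1)

variable {e : Bool} {σ : Equiv.Perm (Fin N)} {c : Fin N → Bool}

lemma gaps_oddMarks (hN : N % 2 = e.toNat) : gaps (oddMarks N) = ends e N := by
  ext g
  have touched (hg0 : g.val ≠ 0) (hg : ¬ (e ∧ g.val = N)) :
      ∃ k : Fin N, k.val % 2 = 1 ∧ Touches g k := by
    obtain odd | even := (Nat.mod_two_eq_zero_or_one g.val).symm
    · refine ⟨⟨g, ?_⟩, odd, Or.inl rfl⟩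
      cases e <;> grind
    · exact ⟨⟨g - 1, by omega⟩, by grind, Or.inr (by grind)⟩
  simp only [gaps, mem_filter_univ, mem_ends, oddMarks, decide_eq_true_eq, Fin.ext_iff,
    Fin.val_zero, Fin.val_last]
  constructor
  · intro free
    by_contra! hg
    obtain ⟨k, odd, hk⟩ := touched hg.1 (by simpa using hg.2)
    exact free k odd hk
  · rintro (hg | ⟨rfl, hg⟩) k odd hk
    · rw [Touches] at hk
      omega
    · rw [Bool.toNat_true] at hN
      rw [Touches] at hk
      omega

lemma eq_oddMarks (h : IsMarked e σ c) (hc : #(innerGaps e c) = 0) : c = oddMarks N := by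
  have zero (i : Fin N) (hi : i.val = 0) : ¬ c i := fun ci =>
    (mem_filter_univ _).mp (ends_subset_iff.mp h.2).1 i ci (Or.inl hi.symm)
  have not_both (i j : Fin N) (hij : i.val + 1 = j.val) (ci : c i) : ¬ c j := fun cj =>
    (h.1 i j ci (Or.inl hij)).asymm (h.1 j i cj (Or.inr hij))
  have one (i j : Fin N) (hij : i.val + 1 = j.val) : c i ∨ c j := by
    have inner : j.castSucc ∉ gaps c := fun hj => by
      have := sdiff_eq_empty_iff_subset.mp (card_eq_zero.mp hc) hj
      grind [mem_ends, Fin.ext_iff]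
    simp only [gaps, mem_filter_univ, not_forall, not_not] at inner
    obtain ⟨k, ck, hk⟩ := inner
    rcases hk with hk | hk
    · exact Or.inr ((Fin.ext hk : j = k) ▸ ck)
    · have : k = i := Fin.ext (Nat.succ_injective (hk.symm.trans hij.symm))
      exact Or.inl (this ▸ ck)
  have odd (m : ℕ) (hm : m < N) : c ⟨m, hm⟩ ↔ m % 2 = 1 := by
    induction m with
    | zero => simpa using zero ⟨0, hm⟩ rfl
    | succ m ih =>
      have := ih (by omega)
      have := not_both ⟨m, by omega⟩ ⟨m + 1, hm⟩ rfl
      have := one ⟨m, by omega⟩ ⟨m + 1, hm⟩ rfl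
      grind
  funext i
  rw [Bool.eq_iff_iff, odd i i.isLt, oddMarks, decide_eq_true_eq]

lemma mem_alternating_iff : σ ∈ alternating N ↔
    ∀ i j, oddMarks N i → (i.val + 1 = j.val ∨ j.val + 1 = i.val) → σ i < σ j := by
  simp only [alternating, mem_filter_univ, oddMarks, decide_eq_true_eq]
  constructor
  · rintro h i j odd (hij | hij)
    · exact (h i j hij).2 odd
    · exact (h j i hij).1 (by omega)
  · exact fun h i j hij =>
      ⟨fun even => h j i (by omega) (Or.inr hij), fun odd => h i j odd (Or.inl hij)⟩

lemma isMarked_oddMarks_iff (hN : N % 2 = e.toNat) :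
    IsMarked e σ (oddMarks N) ↔ σ ∈ alternating N := by
  rw [IsMarked, gaps_oddMarks hN, and_iff_left Subset.rfl, mem_alternating_iff]

lemma markedSum_zero {R : Type*} [CommSemiring R] (p q : R) (hN : N % 2 = e.toNat) :
    markedSum p q e N 0 = ∑ σ ∈ alternating N, markedWeight p q e σ (oddMarks N) := by
  have no_inner : #(innerGaps e (oddMarks N)) = 0 := by
    rw [innerGaps, gaps_oddMarks hN, sdiff_self]
    rfl
  refine sum_nbij' Prod.fst (fun σ => (σ, oddMarks N)) ?_ ?_ ?_ ?_ ?_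
  all_goals simp only [mem_filter_univ]
  · rintro ⟨σ, c⟩ ⟨h, hc⟩
    rwa [eq_oddMarks h hc, isMarked_oddMarks_iff hN] at h
  · exact fun σ hσ => ⟨(isMarked_oddMarks_iff hN).mpr hσ, no_inner⟩
  · exact fun x hx => Prod.ext rfl (eq_oddMarks hx.1 hx.2).symm
  · exact fun _ _ => trivial
  · exact fun x hx => by rw [← eq_oddMarks hx.1 hx.2]

lemma straddles_oddMarks_iff (hσ : σ ∈ alternating N) {i j x : Fin N} (hij : i ≠ j)
    (hj : Touches (sideGap e i) j) :
    Straddles e σ (oddMarks N) i x ↔ σ j < x ∧ x < σ i := by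
  have adjacent : i.val + 1 = j.val ∨ j.val + 1 = i.val := by
    simp only [Touches, val_sideGap, ne_eq, Fin.ext_iff] at hj hij
    grind
  rw [Straddles, and_comm]
  refine and_congr_left fun hx => ?_
  by_cases odd : oddMarks N i
  · have hlt := mem_alternating_iff.mp hσ i j odd adjacent
    exact iff_of_false (fun h => (h i odd (touches_sideGap_self e i)).asymm hx)
      fun h => (h.trans hx).asymm hlt
  · have odd_j : oddMarks N j := by
      simp only [oddMarks, decide_eq_true_eq] at odd ⊢
      omega
    refine ⟨fun h => h j odd_j hj, fun h k odd_k hk => ?_⟩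
    have : k = j := by
      have : k ≠ i := fun hki => odd (hki ▸ odd_k)
      simp only [Touches, val_sideGap, ne_eq, Fin.ext_iff] at *
      grind
    exact this ▸ h

lemma leftCount_oddMarks (hσ : σ ∈ alternating N) : leftCount σ (oddMarks N) = pat31_2 σ := by
  have straddles {i j x : Fin N} (hij : i.val + 1 = j.val) :
      Straddles false σ (oddMarks N) i x ↔ σ j < x ∧ x < σ i :=
    straddles_oddMarks_iff hσ (by grind) (Or.inl hij)
  refine (card_bij (fun x _ => (x.1, x.2.2)) ?_ ?_ ?_).symm
  all_goals simp only [mem_filter_univ, Prod.forall]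
  · exact fun a b c ⟨hab, _, h⟩ => ⟨by omega, (straddles hab).mpr h⟩
  · grind
  · rintro a c ⟨hac, h⟩
    obtain ⟨b, hab⟩ : ∃ b : Fin N, a.val + 1 = b := ⟨⟨a + 1, by omega⟩, rfl⟩
    rw [straddles hab] at h
    exact ⟨(a, b, c), ⟨hab, by grind, h⟩, rfl⟩

lemma rightCount_false_oddMarks (hσ : σ ∈ alternating N) (hN : Even N) :
    rightCount false σ (oddMarks N) = pat2_31 σ := by
  have straddles {i j x : Fin N} (hij : i.val + 1 = j.val) :
      Straddles false σ (oddMarks N) i x ↔ σ j < x ∧ x < σ i :=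
    straddles_oddMarks_iff hσ (by grind) (Or.inl hij)
  refine (card_bij (fun x _ => (x.2.1, x.1)) ?_ ?_ ?_).symm
  all_goals simp only [mem_filter_univ, Prod.forall]
  · exact fun a b c ⟨hab, hbc, h⟩ => ⟨hab, (straddles hbc).mpr h⟩
  · grind
  · rintro b a ⟨hab, h⟩
    have even : ¬ oddMarks N b := fun odd =>
      (h.2 b odd (touches_sideGap_self false b)).asymm h.1
    obtain ⟨c, hbc⟩ : ∃ c : Fin N, b.val + 1 = c := by
      refine ⟨⟨b + 1, ?_⟩, rfl⟩
      rw [oddMarks, decide_eq_true_eq] at even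
      grind
    exact ⟨(a, b, c), ⟨hab, hbc, (straddles hbc).mp h⟩, rfl⟩

lemma rightCount_true_oddMarks (hσ : σ ∈ alternating N) :
    rightCount true σ (oddMarks N) = pat2_13 σ := by
  have straddles {i j x : Fin N} (hij : j.val + 1 = i.val) :
      Straddles true σ (oddMarks N) i x ↔ σ j < x ∧ x < σ i :=
    straddles_oddMarks_iff hσ (by grind) (Or.inr hij.symm)
  refine (card_bij (fun x _ => (x.2.2, x.1)) ?_ ?_ ?_).symm
  all_goals simp only [mem_filter_univ, Prod.forall]
  · exact fun a b c ⟨_, hbc, h⟩ => ⟨by omega, (straddles hbc).mpr h⟩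
  · grind
  · rintro c a ⟨hac, h⟩
    obtain ⟨b, hbc⟩ : ∃ b : Fin N, b.val + 1 = c := ⟨⟨c - 1, by omega⟩, by grind⟩
    rw [straddles hbc] at h
    exact ⟨(a, b, c), ⟨by grind, hbc, h⟩, rfl⟩

variable {R : Type*} [CommSemiring R] (p q : R)

lemma sum_alternating_eq_dyckSum {n : ℕ} (hn : Even n) :
    ∑ σ ∈ alternating n, p ^ pat2_31 σ * q ^ pat31_2 σ =
      dyckSum (fun k => pqNumber p q (k + 1)) (fun k => pqNumber p q (k + 1)) n 0 := by
  refine Eq.trans ?_ (markedSum_eq_dyckSum p q false n 0)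
  rw [Bool.toNat_false, add_zero, markedSum_zero p q (Nat.even_iff.mp hn)]
  refine sum_congr rfl fun σ hσ => ?_
  rw [markedWeight, leftCount_oddMarks hσ, rightCount_false_oddMarks hσ hn]

lemma sum_alternating_succ_eq_dyckSum {r : ℕ} (hr : Even r) :
    ∑ σ ∈ alternating (r + 1), p ^ pat2_13 σ * q ^ pat31_2 σ =
      dyckSum (fun k => pqNumber p q (k + 1)) (fun k => pqNumber p q (k + 2)) r 0 := by
  refine Eq.trans ?_ (markedSum_eq_dyckSum p q true r 0)
  rw [Bool.toNat_true, markedSum_zero p q (Nat.odd_iff.mp hr.add_one)]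
  refine sum_congr rfl fun σ hσ => ?_
  rw [markedWeight, leftCount_oddMarks hσ, rightCount_true_oddMarks hσ]

end Alternating

end MarkedPermutations

end PermStat

theorem mainTheorem4 {R : Type*} [CommRing R] (n : ℕ) (hn : 1 ≤ n) :
    (∀ p q : R,
      ∑ σ : Equiv.Perm (Fin n),
          (-1 : R) ^ PermStat.wex σ * p ^ PermStat.nest σ * q ^ PermStat.cros σ =
        if Even n then 0
        else (-1 : R) ^ ((n + 1) / 2) *
          ∑ σ ∈ PermStat.alternating n,
            p ^ PermStat.pat2_13 σ * q ^ PermStat.pat31_2 σ) ∧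
    (∀ (p : R) (q : Rˣ),
      ∑ σ : derangements (Fin n),
          (-((q⁻¹ : Rˣ) : R)) ^ PermStat.exc σ.val *
            p ^ PermStat.nest σ.val * (q : R) ^ PermStat.cros σ.val =
        if Even n then
          (-((q⁻¹ : Rˣ) : R)) ^ (n / 2) *
            ∑ σ ∈ PermStat.alternating n,
              p ^ PermStat.pat2_31 σ * (q : R) ^ PermStat.pat31_2 σ
        else 0) := by
  obtain ⟨r, rfl⟩ : ∃ r, n = r + 1 := ⟨n - 1, by omega⟩
  refine ⟨fun p q => ?_, fun p q => ?_⟩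
  · rw [PermStat.sum_perm_neg_one_pow_wex_eq_dyckSum, PermStat.dyckSum_one_mul_zero]
    by_cases hr : Even r
    · rw [if_pos hr, if_neg (Nat.not_even_iff_odd.mpr hr.add_one),
        PermStat.sum_alternating_succ_eq_dyckSum p q hr, show (r + 1 + 1) / 2 = r / 2 + 1 by omega,
        pow_succ, mul_neg_one, neg_mul]
    · rw [if_neg hr, if_pos (Nat.not_even_iff_odd.mp hr).add_one, neg_zero]
  · rw [PermStat.sum_derangements_eq_dyckSum p _ (by simp), PermStat.dyckSum_one_mul_zero]
    refine if_ctx_congr Iff.rfl (fun even => ?_) fun _ => rfl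
    rw [PermStat.sum_alternating_eq_dyckSum p _ even]
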